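/- Let $n\ge 1$. For a smooth Hamiltonian $H=H(q,p,t)\in C^\infty(\mathbb R^{n}\times\mathbb R^{n}\times\mathbb R)$ consider the coupled pair of first-order partial differential equations $$\frac{\partial S}{\partial t_0}=-H\bigl(q_0,\nabla_{q_0}S,t_0\bigr),\qquad \frac{\partial S}{\partial t}=H\bigl(q,\nabla_qS,t\bigr)\qquad(1)$$ for a function $S=S(q,t;q_0,t_0)$ on $\mathbb R^{2n+2}$, or, in the other usual sign convention (with $p=\nabla_q S$, $p_0=-\nabla_{q_0}S$), the pair $$\frac{\partial S}{\partial t_0}=H\bigl(q_0,-\nabla_{q_0}S,t_0\bigr),\qquad \frac{\partial S}{\partial t}=-H\bigl(q,\nabla_qS,t\bigr).\qquad(2)$$ Call $H$ globally solvable if the pair has a solution $S\in C^2(\mathbb R^{2n+2})$ that satisfies both equations at all $(q,t;q_0,t_0)$. A finite description of $H$ is a pair of programs: the first computes every partial derivative of $H$ (of every order, including order $0$) at every rational point to within $2^{-k}$, for every given $k$; the second computes a modulus of uniform continuity for every such derivative on every cube $[-N,N]^{2n+1}$. Then, for each of the two sign conventions: (a) There is no algorithm that, given any finite description of any smooth Hamiltonian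 $H$ of $n$ degrees of freedom, halts and correctly answers whether $H$ is globally solvable. (b) The halting problem is many-one reducible to this question: there is a computable map that sends every program $M$ and input $x$ to a finite description of a smooth Hamiltonian $H_{M,x}$ such that $M$ halts on $x$ if and only if $H_{M,x}$ is globally solvable; moreover, if $M$ halts on $x$, then the pair of equations for $H_{M,x}$ even has a solution $S\in C^\infty(\mathbb R^{2n+2})$. -/

import Mathlib

open scoped ContDiff

namespace HPF

/-- The points `(q, p, t)` of extended phase space, `ℝⁿ × ℝⁿ × ℝ`. -/
abbrev PhasePt (n : ℕ) : Type := (Fin n → ℝ) × (Fin n → ℝ) × ℝ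

/-- The points `(q, t; q₀, t₀)` of `ℝ^(2n+2)`. -/
abbrev EndPts (n : ℕ) : Type := (Fin n → ℝ) × ℝ × (Fin n → ℝ) × ℝ

section PDE

variable {n : ℕ}

/-- `∇_q S` at `X = (q, t; q₀, t₀)`. -/
noncomputable def gradQ (S : EndPts n → ℝ) (X : EndPts n) : Fin n → ℝ :=
  fun i => fderiv ℝ S X (Pi.single i 1, 0, 0, 0)

/-- `∂S/∂t` at `X = (q, t; q₀, t₀)`. -/
noncomputable def derivT (S : EndPts n → ℝ) (X : EndPts n) : ℝ :=
  fderiv ℝ S X (0, 1, 0, 0)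

/-- `∇_{q₀} S` at `X = (q, t; q₀, t₀)`. -/
noncomputable def gradQ₀ (S : EndPts n → ℝ) (X : EndPts n) : Fin n → ℝ :=
  fun i => fderiv ℝ S X (0, 0, Pi.single i 1, 0)

/-- `∂S/∂t₀` at `X = (q, t; q₀, t₀)`. -/
noncomputable def derivT₀ (S : EndPts n → ℝ) (X : EndPts n) : ℝ :=
  fderiv ℝ S X (0, 0, 0, 1)

/-- The two sign conventions in use for the pair of equations of Hamilton's principal function. -/
inductive SignConvention : Type
  /-- `∂S/∂t₀ = -H(q₀, ∇_{q₀}S, t₀)` and `∂S/∂t = H(q, ∇_q S, t)`. -/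
  | plus
  /-- `∂S/∂t₀ = H(q₀, -∇_{q₀}S, t₀)` and `∂S/∂t = -H(q, ∇_q S, t)`, that is, the equations
  `∂S/∂t₀ = H₀`, `∂S/∂t = -H` with `p = ∇_q S` and `p₀ = -∇_{q₀} S`. -/
  | minus

/-- `S` satisfies the coupled pair of first-order equations of Hamilton's principal function for
the Hamiltonian `H`, at all `(q, t; q₀, t₀)`. -/
def SolvesPair (H : PhasePt n → ℝ) (S : EndPts n → ℝ) : SignConvention → Prop
  | .plus => ∀ (q : Fin n → ℝ) (t : ℝ) (q₀ : Fin n → ℝ) (t₀ : ℝ),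
      derivT₀ S (q, t, q₀, t₀) = -H (q₀, gradQ₀ S (q, t, q₀, t₀), t₀) ∧
      derivT S (q, t, q₀, t₀) = H (q, gradQ S (q, t, q₀, t₀), t)
  | .minus => ∀ (q : Fin n → ℝ) (t : ℝ) (q₀ : Fin n → ℝ) (t₀ : ℝ),
      derivT₀ S (q, t, q₀, t₀) = H (q₀, -gradQ₀ S (q, t, q₀, t₀), t₀) ∧
      derivT S (q, t, q₀, t₀) = -H (q, gradQ S (q, t, q₀, t₀), t)

/-- The pair of equations has a global solution of class `C²` on all of `ℝ^(2n+2)`. -/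
def GloballySolvable (σ : SignConvention) (H : PhasePt n → ℝ) : Prop :=
  ∃ S : EndPts n → ℝ, ContDiff ℝ 2 S ∧ SolvesPair H S σ

end PDE

section Descriptions

/-- `(a, b, d)` is a notation for the rational number `(a - b) / (d + 1)`. -/
abbrev RatCode : Type := ℕ × ℕ × ℕ

/-- The rational number denoted by `(a, b, d)`, as a real number. -/
noncomputable def RatCode.val (r : RatCode) : ℝ := ((r.1 : ℝ) - r.2.1) / (r.2.2 + 1)

/-- Notations for the rational points of extended phase space. -/
abbrev RatPt (n : ℕ) : Type := (Fin n → RatCode) × (Fin n → RatCode) × RatCode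

/-- The point of extended phase space denoted by `x`. -/
noncomputable def RatPt.val {n : ℕ} (x : RatPt n) : PhasePt n :=
  (fun i => (x.1 i).val, fun i => (x.2.1 i).val, x.2.2.val)

/-- The names of the `2n + 1` coordinates `qᵢ`, `pᵢ`, `t`. -/
abbrev Coord (n : ℕ) : Type := Fin n ⊕ Fin n ⊕ Unit

/-- The unit vector of a coordinate. -/
def Coord.dir {n : ℕ} : Coord n → PhasePt n
  | .inl i => (Pi.single i 1, 0, 0)
  | .inr (.inl i) => (0, Pi.single i 1, 0)
  | .inr (.inr _) => (0, 0, 1)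

/-- The iterated partial derivative of `H` along the coordinates listed in `l`; `H` itself for
the empty list. -/
noncomputable def iterPartial {n : ℕ} (H : PhasePt n → ℝ) : List (Coord n) → PhasePt n → ℝ
  | [] => H
  | i :: l => fun x => fderiv ℝ (iterPartial H l) x i.dir

/-- The numerical code of a finite object, in Mathlib's standard computable coding. -/
def enc {α : Type} [Primcodable α] (a : α) : ℕ := Encodable.encode a

/-- A finite description of a Hamiltonian: two programs. -/
abbrev Description : Type := Nat.Partrec.Code × Nat.Partrec.Code

/-- The description `d` describes the smooth function `H`, in the sense of computable analysis.
The first program, given a list of coordinates, a rational point and `k`, returns a rational number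
within `2⁻ᵏ` of that partial derivative of `H` at that point. The second one, given a list of
coordinates, `N` and `k`, returns an `m` such that this partial derivative varies by at most `2⁻ᵏ`
over distances of at most `2⁻ᵐ` within the cube `[-N, N]^(2n+1)` (the norm is the maximum norm). -/
structure Describes {n : ℕ} (d : Description) (H : PhasePt n → ℝ) : Prop where
  smooth : ContDiff ℝ ∞ H
  approx : ∀ (l : List (Coord n)) (x : RatPt n) (k : ℕ),
    ∃ r : RatCode, enc r ∈ d.1.eval (enc (l, x, k)) ∧
      |r.val - iterPartial H l x.val| ≤ 2⁻¹ ^ k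
  modulus : ∀ (l : List (Coord n)) (N k : ℕ),
    ∃ m : ℕ, m ∈ d.2.eval (enc (l, N, k)) ∧
      ∀ x y : PhasePt n, ‖x‖ ≤ N → ‖y‖ ≤ N → ‖x - y‖ ≤ 2⁻¹ ^ m →
        |iterPartial H l x - iterPartial H l y| ≤ 2⁻¹ ^ k

end Descriptions

/-- The algorithm `D` decides global `C²` solvability for Hamiltonians of `n` degrees of freedom:
on every description of every smooth Hamiltonian it halts with the right answer. Nothing is asked
of `D` on pairs of programs that describe no smooth Hamiltonian. -/
def DecidesSolvability (n : ℕ) (σ : SignConvention) (D : Description →. Bool) : Prop :=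
  ∀ (d : Description) (H : PhasePt n → ℝ), Describes d H →
    ∃ b ∈ D d, (b = true ↔ GloballySolvable σ H)

end HPF

/-! The reduction uses one particle in a potential, `H = pⱼ² + g(qⱼ)`, where `g = ∑ bᵢ qⱼⁱ / i!` and
`bᵢ` depends only on whether `M` has halted on `x` within about `i / 2` steps. If `M` never halts,
every `bᵢ` is `1` and `g` is the exponential function. If `M` halts, the series breaks off at a
negative term of even degree, so `g` is a polynomial bounded above.

A potential below some `E` has the stationary solution `±(E (t - t₀) + ∫ √(E - g))`
(`exists_contDiff_solvesPair_particle`). For `g = exp` there is none. Completing the square shows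
that the action gains at least `inf g - v² / 4` per unit time along a line of velocity `v`. Going
from `0` to `c`, resting there and returning takes time 3 and gains at least `eᶜ - c² / 2`, which is
unbounded in `c`, although the total gain is a fixed number (`not_hamiltonJacobi_exp`).

A description is computable without knowing whether `M` halts: differentiation shifts the
coefficients, and the uniform bound `|bᵢ| ≤ 2` gives explicit truncation errors and moduli
(`exists_computable_description`). -/

namespace HPF

/-! ### Exponential series with bounded coefficients -/

section ExponentialSeries

open scoped Nat

/-- The exponential generating function `∑ bᵢ xⁱ / i!` of the sequence `b`. -/
noncomputable def egf (b : ℕ → ℝ) (x : ℝ) : ℝ := ∑' i, b i * (x ^ i / i !)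

variable {b : ℕ → ℝ} {C : ℝ}

lemma hasSum_pow_div_factorial (x : ℝ) : HasSum (fun i : ℕ => x ^ i / i !) (Real.exp x) := by
  rw [Real.exp_eq_exp_ℝ]
  exact NormedSpace.expSeries_div_hasSum_exp x

lemma abs_egf_term_le (hb : ∀ i, |b i| ≤ C) (x : ℝ) (i : ℕ) :
    |b i * (x ^ i / i !)| ≤ C * (|x| ^ i / i !) := by
  rw [abs_mul, abs_div, abs_pow, Nat.abs_cast]
  exact mul_le_mul_of_nonneg_right (hb i) (by positivity)

lemma summable_egf (hb : ∀ i, |b i| ≤ C) (x : ℝ) : Summable fun i => b i * (x ^ i / i !) :=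
  .of_norm_bounded ((Real.summable_pow_div_factorial |x|).mul_left C) (abs_egf_term_le hb x)

lemma abs_egf_le (hb : ∀ i, |b i| ≤ C) (x : ℝ) : |egf b x| ≤ C * Real.exp |x| := by
  rw [egf, ← Real.norm_eq_abs]
  exact tsum_of_norm_bounded ((hasSum_pow_div_factorial |x|).mul_left C) (abs_egf_term_le hb x)

lemma hasDerivAt_pow_succ_div_factorial (i : ℕ) (x : ℝ) :
    HasDerivAt (fun y : ℝ => y ^ (i + 1) / (i + 1)!) (x ^ i / i !) x := by
  refine ((hasDerivAt_pow (i + 1) x).div_const _).congr_deriv ?_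
  rw [Nat.factorial_succ]
  push_cast
  field_simp

lemma hasDerivAt_egf (hb : ∀ i, |b i| ≤ C) (x : ℝ) :
    HasDerivAt (egf b) (egf (fun i => b (i + 1)) x) x := by
  have hC : 0 ≤ C := (abs_nonneg _).trans (hb 0)
  -- Without its constant term, the series differentiates termwise into the shifted series; the ball
  -- gives a uniform summable bound.
  have key : HasDerivAt (fun z => ∑' i, b (i + 1) * (z ^ (i + 1) / (i + 1)!))
      (∑' i, b (i + 1) * (x ^ i / i !)) x := by
    refine hasDerivAt_tsum_of_isPreconnected (t := Metric.ball 0 (|x| + 1)) (y₀ := 0)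
      ((Real.summable_pow_div_factorial (|x| + 1)).mul_left C)
      Metric.isOpen_ball (convex_ball _ _).isPreconnected
      (fun i y _ => (hasDerivAt_pow_succ_div_factorial i y).const_mul _) (fun i y hy => ?_)
      (by simp; positivity) (by simp [summable_zero]) (by simp)
    refine (abs_egf_term_le (b := fun i => b (i + 1)) (fun i => hb (i + 1)) y i).trans ?_
    have : |y| ≤ |x| + 1 := by simpa using (mem_ball_zero_iff.1 hy).le
    gcongr
  have heq : egf b = fun z => b 0 + ∑' i, b (i + 1) * (z ^ (i + 1) / (i + 1)!) := by
    funext z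
    simpa [egf] using (summable_egf hb z).tsum_eq_zero_add
  rw [heq]
  exact key.const_add _

lemma deriv_egf (hb : ∀ i, |b i| ≤ C) : deriv (egf b) = egf fun i => b (i + 1) :=
  funext fun x => (hasDerivAt_egf hb x).deriv

/-- Each derivative is again a series of this kind with the same bound `C`, so induction on the
order applies. -/
lemma contDiff_egf (hb : ∀ i, |b i| ≤ C) : ContDiff ℝ ∞ (egf b) := by
  refine contDiff_infty.2 fun k => ?_
  induction k generalizing b with
  | zero =>
    exact contDiff_zero.2
      (continuous_iff_continuousAt.2 fun x => (hasDerivAt_egf hb x).continuousAt)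
  | succ k ih =>
    push_cast
    refine contDiff_succ_iff_deriv.2
      ⟨fun x => (hasDerivAt_egf hb x).differentiableAt, by simp, ?_⟩
    rw [deriv_egf hb]
    exact ih fun i => hb (i + 1)

lemma exp_natCast_le_four_pow (N : ℕ) : Real.exp N ≤ 4 ^ N := by
  rw [← Real.exp_one_pow]
  gcongr
  linarith [Real.exp_one_lt_d9]

lemma abs_egf_sub_le (hb : ∀ i, |b i| ≤ C) {N : ℕ} {x y : ℝ} (hx : |x| ≤ N) (hy : |y| ≤ N) :
    |egf b x - egf b y| ≤ C * 4 ^ N * |x - y| := by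
  refine Convex.norm_image_sub_le_of_norm_hasDerivWithin_le (s := Set.Icc (-(N : ℝ)) N)
    (fun z _ => (hasDerivAt_egf hb z).hasDerivWithinAt) (fun z hz => ?_) (convex_Icc _ _)
    (abs_le.1 hy) (abs_le.1 hx)
  have hC : 0 ≤ C := (abs_nonneg _).trans (hb 0)
  refine (abs_egf_le (fun i => hb (i + 1)) z).trans (mul_le_mul_of_nonneg_left ?_ hC)
  exact (Real.exp_le_exp.2 (abs_le.2 hz)).trans (exp_natCast_le_four_pow N)

/-- The tail of the series from index `J` on is at most `C * 2⁻ᴶ * 16ᴬ` on `[-A, A]`. -/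
lemma abs_egf_sub_sum_le (hb : ∀ i, |b i| ≤ C) {A : ℕ} {x : ℝ} (hx : |x| ≤ A) (J : ℕ) :
    |egf b x - ∑ i ∈ Finset.range J, b i * (x ^ i / i !)| ≤ C * (2⁻¹ ^ J * 4 ^ (2 * A)) := by
  have hC : 0 ≤ C := (abs_nonneg _).trans (hb 0)
  have htail : egf b x - ∑ i ∈ Finset.range J, b i * (x ^ i / i !) =
      ∑' i, if i < J then 0 else b i * (x ^ i / i !) := by
    rw [sub_eq_iff_eq_add, egf, ← Finset.tsum_subtype',
      ← (summable_egf hb x).tsum_subtype_add_tsum_subtype_compl (Finset.range J : Set ℕ), add_comm,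
      tsum_subtype (Finset.range J : Set ℕ)ᶜ fun i => b i * (x ^ i / i !)]
    congr 1
    refine tsum_congr fun i => ?_
    by_cases h : i < J <;> simp [Set.indicator, h]
  rw [htail, ← Real.norm_eq_abs]
  have hs : HasSum (fun i : ℕ => C * (2⁻¹ ^ J * ((2 * A : ℝ) ^ i / i !)))
      (C * (2⁻¹ ^ J * Real.exp (2 * A))) :=
    ((hasSum_pow_div_factorial _).mul_left _).mul_left _
  refine (tsum_of_norm_bounded hs fun i => ?_).trans ?_
  · split_ifs with h
    · simp only [norm_zero]; positivity
    · refine (abs_egf_term_le hb x i).trans (mul_le_mul_of_nonneg_left ?_ hC)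
      -- For `i ≥ J` the factor `2 ^ (i - J) ≥ 1` can be inserted; the tail is then dominated by
      -- `2⁻ᴶ` times the full series at `2A`.
      have h2 : (1 : ℝ) ≤ 2⁻¹ ^ J * 2 ^ i := by
        rw [inv_pow, ← div_eq_inv_mul, one_le_div (by positivity)]
        exact pow_le_pow_right₀ (by norm_num) (by omega)
      calc |x| ^ i / i ! ≤ (A : ℝ) ^ i / i ! := by gcongr
        _ ≤ (2⁻¹ ^ J * 2 ^ i) * ((A : ℝ) ^ i / i !) := le_mul_of_one_le_left (by positivity) h2
        _ = _ := by rw [mul_pow]; ring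
  · gcongr
    have := exp_natCast_le_four_pow (2 * A)
    push_cast at this
    exact this

lemma egf_one : egf (fun _ => 1) = Real.exp := by
  funext x
  simpa [egf] using (hasSum_pow_div_factorial x).tsum_eq

/-- The square function is the exponential generating function of `0, 0, 2, 0, 0, …`. -/
lemma egf_square (x : ℝ) : egf (fun i => if i = 2 then 2 else 0) x = x ^ 2 := by
  rw [egf, tsum_eq_single 2 (by intro i hi; simp [hi])]
  simp [Nat.factorial]
  ring

lemma egf_eq_sum {J : ℕ} (hJ : ∀ i, J ≤ i → b i = 0) (x : ℝ) :
    egf b x = ∑ i ∈ Finset.range J, b i * (x ^ i / i !) :=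
  tsum_eq_sum fun i hi => by simp [hJ i (by simpa using hi)]

/-- If the last nonzero term of `b` has even positive index and is negative, then the polynomial
`egf b` is bounded above. -/
lemma exists_egf_le {J : ℕ} (hb : ∀ i, |b i| ≤ C) (hJ : b (2 * (J + 1)) = -1)
    (hJ' : ∀ i, 2 * (J + 1) < i → b i = 0) : ∃ B, ∀ x, egf b x ≤ B := by
  set m := 2 * J + 1
  have hC : 0 ≤ C := (abs_nonneg _).trans (hb 0)
  -- Beyond `R` the leading term of degree `m + 1` outweighs the `m + 1` lower ones, each at most `C
  -- |x| ^ m`.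
  set R : ℝ := max 1 ((m + 1 : ℕ) * C * (m + 1)!)
  refine ⟨C * Real.exp R, fun x => ?_⟩
  rcases le_total |x| R with h | h
  · exact (le_abs_self _).trans ((abs_egf_le hb x).trans (by gcongr))
  · refine le_trans ?_ (show (0 : ℝ) ≤ C * Real.exp R by positivity)
    have h1 : 1 ≤ |x| := (le_max_left _ _).trans h
    rw [egf_eq_sum (J := m + 1 + 1) (fun i hi => hJ' i (by omega)), Finset.sum_range_succ]
    have hlow : ∑ i ∈ Finset.range (m + 1), b i * (x ^ i / i !) ≤ (m + 1 : ℕ) * C * |x| ^ m := by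
      rw [mul_assoc, ← nsmul_eq_mul]
      refine (Finset.sum_le_card_nsmul _ _ (C * |x| ^ m) fun i hi => ?_).trans (by simp)
      refine (le_abs_self _).trans ((abs_egf_term_le hb x i).trans ?_)
      gcongr
      refine (div_le_self (by positivity) (by exact_mod_cast Nat.factorial_pos i)).trans ?_
      exact pow_le_pow_right₀ h1 (by have := Finset.mem_range.1 hi; omega)
    have htop : b (m + 1) * (x ^ (m + 1) / (m + 1)!) = -(|x| ^ m * |x| / (m + 1)!) := by
      rw [show b (m + 1) = -1 from hJ, ← pow_succ, Even.pow_abs (by exact ⟨J + 1, by omega⟩)]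
      ring
    rw [htop]
    have : (m + 1 : ℕ) * C * |x| ^ m ≤ |x| ^ m * |x| / (m + 1)! := by
      rw [le_div_iff₀ (by positivity)]
      have h2 := (le_max_right _ _).trans h
      calc _ = |x| ^ m * ((m + 1 : ℕ) * C * (m + 1)!) := by ring
        _ ≤ _ := by gcongr
    linarith

end ExponentialSeries

/-! ### Solvability for a particle in a potential -/

section Solvability

variable {n : ℕ}

/-- The Hamiltonian `pⱼ² + g(qⱼ)` of a particle in the potential `g`. -/
def particle (j : Fin n) (g : ℝ → ℝ) (x : PhasePt n) : ℝ := g (x.1 j) + x.2.1 j ^ 2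

/-- The action grows along straight lines at least as fast as the Lagrangian prescribes. -/
lemma le_sub_of_hamiltonJacobi {g : ℝ → ℝ} {F : ℝ × ℝ → ℝ} (hF : Differentiable ℝ F)
    (h : ∀ x, fderiv ℝ F x (0, 1) = g x.1 + fderiv ℝ F x (1, 0) ^ 2) (x t v m : ℝ)
    (hm : ∀ s ∈ Set.Ioo (0 : ℝ) 1, m ≤ g (x + s * v)) :
    m - v ^ 2 / 4 ≤ F (x + v, t + 1) - F (x, t) := by
  have hγ (s : ℝ) : HasDerivAt (fun s : ℝ => ((x + s * v, t + s) : ℝ × ℝ)) (v, 1) s := by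
    refine HasDerivAt.prodMk ?_ ((hasDerivAt_id s).const_add t)
    simpa using ((hasDerivAt_id s).mul_const v).const_add x
  have hd (s : ℝ) := (hF (x + s * v, t + s)).hasFDerivAt.comp_hasDerivAt s (hγ s)
  obtain ⟨s, hs, hs'⟩ := exists_hasDerivAt_eq_slope _ _ (zero_lt_one (α := ℝ))
    (fun s _ => (hd s).continuousAt.continuousWithinAt) fun s _ => hd s
  have hsplit : ((v, 1) : ℝ × ℝ) = v • (1, 0) + (0, 1) := by simp
  rw [hsplit, map_add, map_smul, h, smul_eq_mul] at hs'
  simp only [Function.comp, one_mul, zero_mul, add_zero, sub_zero, div_one] at hs'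
  rw [← hs']
  -- With `P` the space derivative of `F`, `P² + v P = (P + v / 2)² - v² / 4`.
  nlinarith [hm s hs, sq_nonneg (fderiv ℝ F (x + s * v, t + s) (1, 0) + v / 2)]

/-- The Hamilton–Jacobi equation with the potential `eˣ` has no global differentiable solution:
the action would gain arbitrarily much on a round trip from `0` to a distant point `c`. -/
lemma not_hamiltonJacobi_exp {F : ℝ × ℝ → ℝ} (hF : Differentiable ℝ F)
    (h : ∀ x, fderiv ℝ F x (0, 1) = Real.exp x.1 + fderiv ℝ F x (1, 0) ^ 2) : False := by
  -- The distance is the size of the gain itself: `eᶜ - c² / 2 ≥ 1 + c` then exceeds it.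
  set c := |F (0, 3) - F (0, 0)|
  have h₁ := le_sub_of_hamiltonJacobi hF h 0 0 c 0 fun s _ => (Real.exp_pos _).le
  have h₂ := le_sub_of_hamiltonJacobi hF h c 1 0 (Real.exp c) fun s _ => by simp
  have h₃ := le_sub_of_hamiltonJacobi hF h c 2 (-c) 0 fun s _ => (Real.exp_pos _).le
  norm_num at h₁ h₂ h₃
  have h₄ := Real.quadratic_le_exp_of_nonneg (abs_nonneg (F (0, 3) - F (0, 0)))
  have h₅ := le_abs_self (F (0, 3) - F (0, 0))
  change _ ≤ c at h₅
  change 1 + c + c ^ 2 / 2 ≤ Real.exp c at h₄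
  linarith

/-- The sign with which the Hamiltonian enters the evolution in `t`. -/
def SignConvention.sign : SignConvention → ℝ
  | .plus => 1
  | .minus => -1

lemma SignConvention.sign_mul_self (σ : SignConvention) : σ.sign * σ.sign = 1 := by
  cases σ <;> simp [sign]

lemma solvesPair_particle_iff (j : Fin n) (g : ℝ → ℝ) (S : EndPts n → ℝ) (σ : SignConvention) :
    SolvesPair (particle j g) S σ ↔ ∀ (q : Fin n → ℝ) (t : ℝ) (q₀ : Fin n → ℝ) (t₀ : ℝ),
      derivT₀ S (q, t, q₀, t₀) = -σ.sign * (g (q₀ j) + gradQ₀ S (q, t, q₀, t₀) j ^ 2) ∧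
      derivT S (q, t, q₀, t₀) = σ.sign * (g (q j) + gradQ S (q, t, q₀, t₀) j ^ 2) := by
  cases σ <;> simp [SolvesPair, particle, SignConvention.sign, add_comm]

theorem not_globallySolvable_particle_exp (j : Fin n) (σ : SignConvention) :
    ¬ GloballySolvable σ (particle j Real.exp) := by
  rintro ⟨S, hS, hpair⟩
  rw [solvesPair_particle_iff] at hpair
  -- Only the second equation is needed, on the `j`-th axis with `q₀ = 0` and `t₀ = 0`. Multiplying
  -- `S` by the sign gives the same equation in both conventions.
  let L : ℝ × ℝ →L[ℝ] EndPts n :=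
    ((ContinuousLinearMap.single ℝ (fun _ : Fin n => ℝ) j).comp (.fst ℝ ℝ ℝ)).prod
      ((ContinuousLinearMap.snd ℝ ℝ ℝ).prod 0)
  have hL (x : ℝ × ℝ) : L x = (Pi.single j x.1, x.2, 0, 0) := rfl
  have hSd : Differentiable ℝ S := hS.differentiable (by norm_num)
  have hd (x : ℝ × ℝ) : HasFDerivAt (fun x => σ.sign * S (L x))
      (σ.sign • (fderiv ℝ S (L x)).comp L) x :=
    ((hSd (L x)).hasFDerivAt.comp x L.hasFDerivAt).const_mul σ.sign
  refine not_hamiltonJacobi_exp (fun x => (hd x).differentiableAt) fun x => ?_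
  obtain ⟨-, h⟩ := hpair (Pi.single j x.1) x.2 0 0
  rw [(hd x).fderiv]
  simp only [derivT, gradQ, Pi.single_eq_same] at h
  simp only [smul_apply, ContinuousLinearMap.comp_apply, smul_eq_mul, hL,
    Pi.single_zero]
  rw [h, ← mul_assoc, σ.sign_mul_self, one_mul, mul_pow, pow_two σ.sign, σ.sign_mul_self, one_mul]

lemma contDiff_integral {f : ℝ → ℝ} (hf : ContDiff ℝ ∞ f) :
    ContDiff ℝ ∞ fun x => ∫ s in (0 : ℝ)..x, f s := by
  have hd (x : ℝ) : HasDerivAt (fun x => ∫ s in (0 : ℝ)..x, f s) (f x) x :=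
    (hf.continuous.integral_hasStrictDerivAt 0 x).hasDerivAt
  refine contDiff_infty_iff_deriv.2 ⟨fun x => (hd x).differentiableAt, ?_⟩
  rwa [funext fun x => (hd x).deriv]

/-- Above its maximum the potential admits a smooth stationary solution
`E (t - t₀) + ∫ √(E - g)`. -/
theorem exists_contDiff_solvesPair_particle (j : Fin n) (σ : SignConvention) {g : ℝ → ℝ}
    (hg : ContDiff ℝ ∞ g) {B : ℝ} (hB : ∀ x, g x ≤ B) :
    ∃ S : EndPts n → ℝ, ContDiff ℝ ∞ S ∧ SolvesPair (particle j g) S σ := by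
  -- The energy `B + 1` instead of `B` keeps the radicand positive, hence its root smooth.
  have hpos (x : ℝ) : 0 < B + 1 - g x := by linarith [hB x]
  have hw : ContDiff ℝ ∞ fun x => √(B + 1 - g x) :=
    (contDiff_const.sub hg).sqrt fun x => (hpos x).ne'
  set W : ℝ → ℝ := fun x => ∫ s in (0 : ℝ)..x, √(B + 1 - g s)
  have hWd (x : ℝ) : HasDerivAt W (√(B + 1 - g x)) x :=
    (hw.continuous.integral_hasStrictDerivAt 0 x).hasDerivAt
  have hWc : ContDiff ℝ ∞ W := contDiff_integral hw
  let S : EndPts n → ℝ := fun X =>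
    σ.sign * ((B + 1) * (X.2.1 - X.2.2.2) + (W (X.1 j) - W (X.2.2.1 j)))
  have hS : ContDiff ℝ ∞ S := by
    have h₁ : ContDiff ℝ ∞ fun X : EndPts n => X.1 j := by fun_prop
    have h₂ : ContDiff ℝ ∞ fun X : EndPts n => X.2.2.1 j := by fun_prop
    have h₃ := hWc.comp h₁
    have h₄ := hWc.comp h₂
    exact contDiff_const.mul ((by fun_prop : ContDiff ℝ ∞ fun X : EndPts n =>
      (B + 1) * (X.2.1 - X.2.2.2)).add (h₃.sub h₄))
  have hdir (X v : EndPts n) : fderiv ℝ S X v = σ.sign * ((B + 1) * (v.2.1 - v.2.2.2) +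
      (√(B + 1 - g (X.1 j)) * v.1 j - √(B + 1 - g (X.2.2.1 j)) * v.2.2.1 j)) := by
    rw [← ((hS.differentiable (by simp)) X).lineDeriv_eq_fderiv]
    refine HasLineDerivAt.lineDeriv ?_
    have hlin (a c : ℝ) : HasDerivAt (fun s : ℝ => a + s * c) c 0 := by
      simpa using ((hasDerivAt_id (0 : ℝ)).mul_const c).const_add a
    have hcomp (a c : ℝ) : HasDerivAt (fun s : ℝ => W (a + s * c)) (√(B + 1 - g a) * c) 0 :=
      HasDerivAt.comp (h := fun s : ℝ => a + s * c) (h₂ := W) 0 (by simpa using hWd a) (hlin a c)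
    exact ((((hlin _ _).sub (hlin _ _)).const_mul _).add
      ((hcomp _ _).sub (hcomp _ _))).const_mul _
  refine ⟨S, hS, (solvesPair_particle_iff j g S σ).2 fun q t q₀ t₀ => ?_⟩
  have hs := σ.sign_mul_self
  have h₁ := Real.sq_sqrt (hpos (q j)).le
  have h₂ := Real.sq_sqrt (hpos (q₀ j)).le
  simp only [derivT₀, derivT, gradQ, gradQ₀, hdir]
  simp only [Pi.single_eq_same, Pi.zero_apply, mul_pow, mul_one, mul_zero, zero_sub, sub_zero,
    zero_add, add_zero, neg_sq, h₁, h₂, pow_two σ.sign, hs]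
  constructor <;> ring

theorem globallySolvable_of_contDiff {σ : SignConvention} {H : PhasePt n → ℝ}
    (h : ∃ S : EndPts n → ℝ, ContDiff ℝ ∞ S ∧ SolvesPair H S σ) : GloballySolvable σ H :=
  let ⟨S, hS, hS'⟩ := h
  ⟨S, by exact_mod_cast contDiff_infty.1 hS 2, hS'⟩

end Solvability

/-! ### Partial derivatives of the separated Hamiltonian -/

section PartialDerivatives

variable {n : ℕ}

/-- `1` if all the coordinates in the list are `c`, and `0` otherwise. -/
def indicatorAll (c : Coord n) (l : List (Coord n)) : ℕ :=
  l.foldr (fun i s => if i = c then s else 0) 1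

lemma indicatorAll_cons (c i : Coord n) (l : List (Coord n)) :
    indicatorAll c (i :: l) = if i = c then indicatorAll c l else 0 := rfl

lemma indicatorAll_le_one (c : Coord n) (l : List (Coord n)) : indicatorAll c l ≤ 1 := by
  induction l with
  | nil => exact le_rfl
  | cons i l ih => rw [indicatorAll_cons]; split_ifs <;> simp [ih]

lemma Coord.dir_fst (i : Coord n) (j : Fin n) : i.dir.1 j = if i = .inl j then 1 else 0 := by
  rcases i with i | i | i <;> simp [Coord.dir, Pi.single_apply, eq_comm]

lemma Coord.dir_snd_fst (i : Coord n) (j : Fin n) :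
    i.dir.2.1 j = if i = .inr (.inl j) then 1 else 0 := by
  rcases i with i | i | i <;> simp [Coord.dir, Pi.single_apply, eq_comm]

variable {a b : ℕ → ℝ} {C : ℝ}

lemma contDiff_egf_add_egf (ha : ∀ i, |a i| ≤ C) (hb : ∀ i, |b i| ≤ C) (j : Fin n) :
    ContDiff ℝ ∞ fun x : PhasePt n => egf a (x.1 j) + egf b (x.2.1 j) :=
  ((contDiff_egf ha).comp (by fun_prop : ContDiff ℝ ∞ fun x : PhasePt n => x.1 j)).add
    ((contDiff_egf hb).comp (by fun_prop : ContDiff ℝ ∞ fun x : PhasePt n => x.2.1 j))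

/-- The variables are separated, so a summand survives only if every differentiation is in its own
variable. For the empty list both indicators are `1`. -/
lemma iterPartial_egf_add_egf (ha : ∀ i, |a i| ≤ C) (hb : ∀ i, |b i| ≤ C) (j : Fin n)
    (l : List (Coord n)) :
    iterPartial (fun x : PhasePt n => egf a (x.1 j) + egf b (x.2.1 j)) l = fun x =>
      indicatorAll (.inl j) l * egf (fun i => a (i + l.length)) (x.1 j) +
      indicatorAll (.inr (.inl j)) l * egf (fun i => b (i + l.length)) (x.2.1 j) := by
  induction l with
  | nil => simp [iterPartial, indicatorAll]
  | cons i l ih =>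
    funext x
    rw [iterPartial, ih]
    let L₁ : PhasePt n →L[ℝ] ℝ :=
      (ContinuousLinearMap.proj (R := ℝ) (φ := fun _ : Fin n => ℝ) j).comp (.fst ℝ _ _)
    let L₂ : PhasePt n →L[ℝ] ℝ :=
      (ContinuousLinearMap.proj (R := ℝ) (φ := fun _ : Fin n => ℝ) j).comp
        ((ContinuousLinearMap.fst ℝ _ _).comp (.snd ℝ _ _))
    have h₁ : HasFDerivAt (fun x : PhasePt n => x.1 j) L₁ x := L₁.hasFDerivAt
    have h₂ : HasFDerivAt (fun x : PhasePt n => x.2.1 j) L₂ x := L₂.hasFDerivAt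
    have h := ((((hasDerivAt_egf (fun i => ha (i + l.length)) (x.1 j)).comp_hasFDerivAt x
      h₁).const_mul (indicatorAll (.inl j) l : ℝ)).add
      (((hasDerivAt_egf (fun i => hb (i + l.length)) (x.2.1 j)).comp_hasFDerivAt x
      h₂).const_mul (indicatorAll (.inr (.inl j)) l : ℝ)))
    refine (congrArg (fun L => L i.dir) h.fderiv).trans ?_
    simp only [L₁, L₂, add_apply, smul_apply, ContinuousLinearMap.comp_apply,
      ContinuousLinearMap.proj_apply,
      ContinuousLinearMap.coe_fst', ContinuousLinearMap.coe_snd', smul_eq_mul, Coord.dir_fst,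
      Coord.dir_snd_fst, indicatorAll_cons, List.length_cons, add_assoc, add_comm 1]
    split_ifs <;> simp

lemma abs_iterPartial_sub_le (ha : ∀ i, |a i| ≤ 2) (hb : ∀ i, |b i| ≤ 2) (j : Fin n)
    (l : List (Coord n)) {N k : ℕ} {x y : PhasePt n} (hx : ‖x‖ ≤ N) (hy : ‖y‖ ≤ N)
    (hxy : ‖x - y‖ ≤ 2⁻¹ ^ (k + 2 + 2 * N)) :
    |iterPartial (fun x : PhasePt n => egf a (x.1 j) + egf b (x.2.1 j)) l x -
      iterPartial (fun x : PhasePt n => egf a (x.1 j) + egf b (x.2.1 j)) l y| ≤ 2⁻¹ ^ k := by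
  have hfst (z : PhasePt n) : |z.1 j| ≤ ‖z‖ := (norm_le_pi_norm z.1 j).trans (norm_fst_le z)
  have hsnd (z : PhasePt n) : |z.2.1 j| ≤ ‖z‖ :=
    (norm_le_pi_norm z.2.1 j).trans ((norm_fst_le z.2).trans (norm_snd_le z))
  have key {b : ℕ → ℝ} (hb : ∀ i, |b i| ≤ 2) (c : Coord n) {u v : ℝ} (hu : |u| ≤ N)
      (hv : |v| ≤ N) (huv : |u - v| ≤ 2⁻¹ ^ (k + 2 + 2 * N)) :
      |indicatorAll c l * (egf (fun i => b (i + l.length)) u -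
        egf (fun i => b (i + l.length)) v)| ≤ 2⁻¹ ^ (k + 1) := by
    rw [abs_mul, Nat.abs_cast]
    refine (mul_le_of_le_one_left (abs_nonneg _)
      (by exact_mod_cast indicatorAll_le_one c l)).trans ?_
    refine (abs_egf_sub_le (fun i => hb (i + l.length)) hu hv).trans ?_
    -- The Lipschitz constant is at most `2 * 4 ^ N`; the two summands share the error `2⁻ᵏ`
    -- equally.
    calc 2 * 4 ^ N * |u - v| ≤ 2 * 4 ^ N * 2⁻¹ ^ (k + 2 + 2 * N) := by gcongr
      _ = 2⁻¹ ^ (k + 1) * (4 ^ N * (2⁻¹ ^ 2) ^ N) := by rw [pow_add, pow_mul]; ring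
      _ = 2⁻¹ ^ (k + 1) := by rw [← mul_pow]; norm_num
  rw [iterPartial_egf_add_egf ha hb]
  have h₁ := key ha (.inl j) ((hfst x).trans hx) ((hfst y).trans hy) ((hfst (x - y)).trans hxy)
  have h₂ := key hb (.inr (.inl j)) ((hsnd x).trans hx) ((hsnd y).trans hy)
    ((hsnd (x - y)).trans hxy)
  have h₃ : (2⁻¹ : ℝ) ^ k = 2⁻¹ ^ (k + 1) + 2⁻¹ ^ (k + 1) := by rw [pow_succ]; ring
  rw [h₃]
  refine le_trans (le_of_eq (congrArg _ ?_)) ((abs_add_le _ _).trans (add_le_add h₁ h₂))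
  ring

end PartialDerivatives

/-! ### Exact arithmetic on notations for rationals -/

section RationalArithmetic

open scoped Nat

namespace RatCode

/-- Addition of notations for rational numbers. -/
def add (r s : RatCode) : RatCode :=
  (r.1 * (s.2.2 + 1) + s.1 * (r.2.2 + 1), r.2.1 * (s.2.2 + 1) + s.2.1 * (r.2.2 + 1),
    (r.2.2 + 1) * (s.2.2 + 1) - 1)

/-- Multiplication of notations for rational numbers. -/
def mul (r s : RatCode) : RatCode :=
  (r.1 * s.1 + r.2.1 * s.2.1, r.1 * s.2.1 + r.2.1 * s.1, (r.2.2 + 1) * (s.2.2 + 1) - 1)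

/-- Denominators are stored minus one; the truncated subtraction is exact because the product is
positive. -/
lemma cast_den_mul (d e : ℕ) : (((d + 1) * (e + 1) - 1 : ℕ) : ℝ) + 1 = (d + 1) * (e + 1) := by
  have : (d + 1) * (e + 1) - 1 + 1 = (d + 1) * (e + 1) := Nat.sub_add_cancel (Nat.mul_pos d.succ_pos e.succ_pos)
  exact_mod_cast this

lemma val_add (r s : RatCode) : (add r s).val = r.val + s.val := by
  simp only [val, add, cast_den_mul]
  push_cast
  field_simp
  ring

lemma val_mul (r s : RatCode) : (mul r s).val = r.val * s.val := by
  simp only [val, mul, cast_den_mul]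
  push_cast
  field_simp
  ring

/-- A notation for `rⁱ / i!`. -/
def powDivFactorial (r : RatCode) (i : ℕ) : RatCode :=
  i.rec (1, 0, 0) fun i s => mul (mul s r) (1, 0, i)

lemma val_powDivFactorial (r : RatCode) (i : ℕ) :
    (powDivFactorial r i).val = r.val ^ i / i ! := by
  induction i with
  | zero => simp [powDivFactorial, val]
  | succ i ih =>
    change (mul (mul (powDivFactorial r i) r) (1, 0, i)).val = _
    rw [val_mul, val_mul, ih, Nat.factorial_succ, pow_succ]
    simp only [val]
    push_cast
    field_simp
    simp

/-- A notation for `∑ (uᵢ - vᵢ) rⁱ / i!`, summed over `i < J`. -/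
def egfSum (u v : ℕ → ℕ) (r : RatCode) (J : ℕ) : RatCode :=
  J.rec (0, 0, 0) fun i s => add s (mul (u i, v i, 0) (powDivFactorial r i))

lemma val_egfSum (u v : ℕ → ℕ) (r : RatCode) (J : ℕ) :
    (egfSum u v r J).val = ∑ i ∈ Finset.range J, ((u i : ℝ) - v i) * (r.val ^ i / i !) := by
  induction J with
  | zero => simp [egfSum, val]
  | succ J ih =>
    change (add (egfSum u v r J) (mul (u J, v J, 0) (powDivFactorial r J))).val = _
    rw [val_add, val_mul, ih, Finset.sum_range_succ, val_powDivFactorial]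
    simp [val]

/-- The number of terms of the exponential series at `r` that give it with accuracy `2⁻ᵏ`. -/
def cutoff (r : RatCode) (k : ℕ) : ℕ := k + 2 + 4 * (r.1 + r.2.1)

lemma abs_val_le (r : RatCode) : |r.val| ≤ (r.1 + r.2.1 : ℕ) := by
  rw [val, abs_div, abs_of_pos (by positivity : (0 : ℝ) < r.2.2 + 1)]
  refine (div_le_self (abs_nonneg _) (by simp)).trans ((abs_sub _ _).trans ?_)
  simp

/-- With `A = r.1 + r.2.1 ≥ |r|`, the `4 * A` in `cutoff` cancels the factor `16 ^ A` of the tail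
bound. -/
lemma abs_val_egfSum_sub_le {u v : ℕ → ℕ} {b : ℕ → ℝ} (huv : ∀ i, (u i : ℝ) - v i = b i)
    (hb : ∀ i, |b i| ≤ 2) (r : RatCode) (k : ℕ) :
    |(egfSum u v r (cutoff r k)).val - egf b r.val| ≤ 2⁻¹ ^ (k + 1) := by
  rw [abs_sub_comm, val_egfSum]
  simp only [huv]
  refine (abs_egf_sub_sum_le hb r.abs_val_le _).trans (le_of_eq ?_)
  rw [cutoff]
  set A := r.1 + r.2.1
  calc (2 : ℝ) * (2⁻¹ ^ (k + 2 + 4 * A) * 4 ^ (2 * A))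
      = 2⁻¹ ^ (k + 1) * ((2⁻¹ ^ 4) ^ A * (4 ^ 2) ^ A) := by
        rw [pow_add, pow_mul, pow_mul]; ring
    _ = 2⁻¹ ^ (k + 1) := by rw [← mul_pow]; norm_num

end RatCode

end RationalArithmetic

/-! ### Coefficients that watch a computation -/

section Programs

open Nat.Partrec (Code)

/-- `0` if the program `M` halts on `x` within `k` steps, and `1` otherwise. -/
def running (M : Code) (x k : ℕ) : ℕ := if (M.evaln k x).isSome then 0 else 1

/-- The positive part of the coefficients of the potential. -/
def coeffPos (M : Code) (x i : ℕ) : ℕ := 2 * running M x ((i + 1) / 2)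

/-- The negative part of the coefficients of the potential. -/
def coeffNeg (M : Code) (x i : ℕ) : ℕ := running M x ((i + 1) / 2 - 1)

/-- The coefficients of the potential: `1` as long as `M` runs on `x`, then `-1` twice, the second
time at an even index, and then `0`. -/
def coeff (M : Code) (x i : ℕ) : ℝ := (coeffPos M x i : ℝ) - coeffNeg M x i

/-- The coefficients of the square function. -/
def coeffSquare (i : ℕ) : ℕ := if i = 2 then 2 else 0

lemma abs_coeff_le (M : Code) (x i : ℕ) : |coeff M x i| ≤ 2 := by
  have h (k : ℕ) : running M x k = 0 ∨ running M x k = 1 := by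
    unfold running; split_ifs <;> simp
  unfold coeff coeffPos coeffNeg
  rcases h ((i + 1) / 2) with h₁ | h₁ <;> rcases h ((i + 1) / 2 - 1) with h₂ | h₂ <;>
    norm_num [h₁, h₂]

lemma abs_coeffSquare_le (i : ℕ) : |(coeffSquare i : ℝ)| ≤ 2 := by
  unfold coeffSquare; split_ifs <;> simp

lemma running_eq_one {M : Code} {x : ℕ} (h : ¬ (M.eval x).Dom) (k : ℕ) : running M x k = 1 := by
  refine if_neg fun hk => h ?_
  obtain ⟨y, hy⟩ := Option.isSome_iff_exists.1 hk
  exact Part.dom_iff_mem.2 ⟨y, Code.evaln_sound hy⟩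

/-- Halting is monotone in the step bound; `s` is the last bound at which `M` still runs. -/
lemma exists_running_eq_zero_iff {M : Code} {x : ℕ} (h : (M.eval x).Dom) :
    ∃ s, ∀ k, running M x k = 0 ↔ s < k := by
  have hex : ∃ s, (M.evaln s x).isSome := by
    obtain ⟨y, hy⟩ := Part.dom_iff_mem.1 h
    obtain ⟨s, hs⟩ := Code.evaln_complete.1 hy
    exact ⟨s, Option.isSome_iff_exists.2 ⟨y, hs⟩⟩
  have hmono {k k' : ℕ} (hk : k ≤ k') (h : (M.evaln k x).isSome) : (M.evaln k' x).isSome := by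
    obtain ⟨y, hy⟩ := Option.isSome_iff_exists.1 h
    exact Option.isSome_iff_exists.2 ⟨y, Code.evaln_mono hk hy⟩
  -- `evaln` with bound `0` never succeeds, so subtracting `1` below loses nothing.
  have hpos : Nat.find hex ≠ 0 := fun h0 => by
    have := Nat.find_spec hex
    rw [h0] at this
    simp [Code.evaln] at this
  refine ⟨Nat.find hex - 1, fun k => ?_⟩
  have h₁ : running M x k = 0 ↔ (M.evaln k x).isSome := by
    unfold running; split_ifs with h <;> simp [h]
  have h₂ : (M.evaln k x).isSome ↔ Nat.find hex ≤ k :=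
    ⟨fun h => Nat.find_min' hex h, fun h => hmono h (Nat.find_spec hex)⟩
  rw [h₁, h₂]
  omega

lemma egf_coeff_of_not_dom {M : Code} {x : ℕ} (h : ¬ (M.eval x).Dom) :
    egf (coeff M x) = Real.exp := by
  rw [← egf_one]
  congr 1
  funext i
  simp only [coeff, coeffPos, coeffNeg, running_eq_one h]
  norm_num

lemma exists_egf_coeff_le {M : Code} {x : ℕ} (h : (M.eval x).Dom) :
    ∃ B, ∀ y, egf (coeff M x) y ≤ B := by
  obtain ⟨s, hs⟩ := exists_running_eq_zero_iff h
  have hone {k : ℕ} (hk : k ≤ s) : running M x k = 1 := by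
    have := mt (hs k).1 (by omega)
    unfold running at this ⊢
    split_ifs at this ⊢ <;> simp_all
  refine exists_egf_le (J := s) (abs_coeff_le M x) ?_ fun i hi => ?_
  -- At index `2 * (s + 1)` the two step bounds are `s + 1` and `s`, giving `0 - 1`. At later
  -- indices both exceed `s`.
  · simp only [coeff, coeffPos, coeffNeg]
    rw [(hs _).2 (by omega), hone (by omega)]
    norm_num
  · simp only [coeff, coeffPos, coeffNeg]
    rw [(hs _).2 (by omega), (hs _).2 (by omega)]
    norm_num

lemma particle_egf_coeff {n : ℕ} (j : Fin n) (M : Code) (x : ℕ) :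
    particle j (egf (coeff M x)) =
      fun X => egf (coeff M x) (X.1 j) + egf (fun i => (coeffSquare i : ℝ)) (X.2.1 j) := by
  funext X
  have h : (fun i => (coeffSquare i : ℝ)) = fun i => if i = 2 then 2 else 0 := by
    funext i; unfold coeffSquare; split_ifs <;> simp
  rw [h, egf_square, particle]

/-- The approximation to a partial derivative of the Hamiltonian that is computed from `M` and `x`,
the list of coordinates, the point and the accuracy. -/
def approximation {n : ℕ} (j : Fin n) (a : (Code × ℕ) × List (Coord n) × RatPt n × ℕ) : RatCode :=
  .add
    (.mul (indicatorAll (.inl j) a.2.1, 0, 0)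
      (.egfSum (fun i => coeffPos a.1.1 a.1.2 (i + a.2.1.length))
        (fun i => coeffNeg a.1.1 a.1.2 (i + a.2.1.length))
        (a.2.2.1.1 j) (RatCode.cutoff (a.2.2.1.1 j) a.2.2.2)))
    (.mul (indicatorAll (.inr (.inl j)) a.2.1, 0, 0)
      (.egfSum (fun i => coeffSquare (i + a.2.1.length)) (fun _ => 0)
        (a.2.2.1.2.1 j) (RatCode.cutoff (a.2.2.1.2.1 j) a.2.2.2)))

lemma abs_val_approximation_sub_le {n : ℕ} (j : Fin n) (M : Code) (x : ℕ) (l : List (Coord n))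
    (X : RatPt n) (k : ℕ) :
    |(approximation j ((M, x), l, X, k)).val -
      iterPartial (particle j (egf (coeff M x))) l X.val| ≤ 2⁻¹ ^ k := by
  rw [particle_egf_coeff, iterPartial_egf_add_egf (abs_coeff_le M x) abs_coeffSquare_le,
    approximation, RatCode.val_add, RatCode.val_mul, RatCode.val_mul]
  have hone (c : ℕ) : RatCode.val (c, 0, 0) = c := by simp [RatCode.val]
  have key (c : Coord n) {y z : ℝ} (h : |y - z| ≤ 2⁻¹ ^ (k + 1)) :
      |(indicatorAll c l : ℝ) * (y - z)| ≤ 2⁻¹ ^ (k + 1) := by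
    rw [abs_mul, Nat.abs_cast]
    exact (mul_le_of_le_one_left (abs_nonneg _)
      (by exact_mod_cast indicatorAll_le_one c l)).trans h
  have h₁ := key (.inl j) (RatCode.abs_val_egfSum_sub_le
    (u := fun i => coeffPos M x (i + l.length)) (v := fun i => coeffNeg M x (i + l.length))
    (b := fun i => coeff M x (i + l.length)) (fun i => rfl) (fun i => abs_coeff_le M x _) (X.1 j) k)
  have h₂ := key (.inr (.inl j)) (RatCode.abs_val_egfSum_sub_le
    (u := fun i => coeffSquare (i + l.length)) (v := fun _ => 0)
    (b := fun i => (coeffSquare (i + l.length) : ℝ)) (fun i => by simp)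
    (fun i => abs_coeffSquare_le _) (X.2.1 j) k)
  have h₃ : (2⁻¹ : ℝ) ^ k = 2⁻¹ ^ (k + 1) + 2⁻¹ ^ (k + 1) := by rw [pow_succ]; ring
  rw [h₃]
  refine le_trans (le_of_eq (congrArg _ ?_)) ((abs_add_le _ _).trans (add_le_add h₁ h₂))
  simp only [hone, RatPt.val]
  ring

end Programs

/-! ### Computability of the descriptions and the reduction -/

section Computability

open Nat.Partrec (Code)

/-- The `s-m-n` theorem for total functions on coded types. -/
lemma exists_computable_code {α β γ : Type} [Primcodable α] [Primcodable β] [Primcodable γ]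
    {F : α × β → γ} (hF : Computable F) :
    ∃ c : α → Code, Computable c ∧ ∀ a b, enc (F (a, b)) ∈ (c a).eval (enc b) := by
  obtain ⟨c, hc⟩ := Code.exists_code.1 hF
  refine ⟨fun a => c.curry (Encodable.encode a),
    (Code.primrec₂_curry.comp (.const c) .encode).to_comp, fun a b => ?_⟩
  rw [Code.eval_curry, hc, enc, enc, ← Encodable.encode_prod_val]
  simp

section

variable {α : Type} [Primcodable α]

lemma primrec_ratCode_mk {f g h : α → ℕ} (hf : Primrec f) (hg : Primrec g) (hh : Primrec h) :
    Primrec fun a => ((f a, g a, h a) : RatCode) :=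
  hf.pair (hg.pair hh)

lemma primrec_den_mul {r s : α → RatCode} (hr : Primrec r) (hs : Primrec s) :
    Primrec fun a => ((r a).2.2 + 1) * ((s a).2.2 + 1) - 1 :=
  Primrec.nat_sub.comp (Primrec.nat_mul.comp (Primrec.succ.comp (Primrec.snd.comp (.comp .snd hr)))
    (Primrec.succ.comp (Primrec.snd.comp (.comp .snd hs)))) (.const 1)

lemma primrec_ratCode_add {r s : α → RatCode} (hr : Primrec r) (hs : Primrec s) :
    Primrec fun a => RatCode.add (r a) (s a) := by
  have hr₁ := Primrec.fst.comp hr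
  have hr₂ := Primrec.fst.comp (Primrec.snd.comp hr)
  have hr₃ := Primrec.succ.comp (Primrec.snd.comp (Primrec.snd.comp hr))
  have hs₁ := Primrec.fst.comp hs
  have hs₂ := Primrec.fst.comp (Primrec.snd.comp hs)
  have hs₃ := Primrec.succ.comp (Primrec.snd.comp (Primrec.snd.comp hs))
  exact primrec_ratCode_mk
    (Primrec.nat_add.comp (Primrec.nat_mul.comp hr₁ hs₃) (Primrec.nat_mul.comp hs₁ hr₃))
    (Primrec.nat_add.comp (Primrec.nat_mul.comp hr₂ hs₃) (Primrec.nat_mul.comp hs₂ hr₃))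
    (primrec_den_mul hr hs)

lemma primrec_ratCode_mul {r s : α → RatCode} (hr : Primrec r) (hs : Primrec s) :
    Primrec fun a => RatCode.mul (r a) (s a) := by
  have hr₁ := Primrec.fst.comp hr
  have hr₂ := Primrec.fst.comp (Primrec.snd.comp hr)
  have hs₁ := Primrec.fst.comp hs
  have hs₂ := Primrec.fst.comp (Primrec.snd.comp hs)
  exact primrec_ratCode_mk
    (Primrec.nat_add.comp (Primrec.nat_mul.comp hr₁ hs₁) (Primrec.nat_mul.comp hr₂ hs₂))
    (Primrec.nat_add.comp (Primrec.nat_mul.comp hr₁ hs₂) (Primrec.nat_mul.comp hr₂ hs₁))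
    (primrec_den_mul hr hs)

lemma primrec_powDivFactorial {r : α → RatCode} {k : α → ℕ} (hr : Primrec r) (hk : Primrec k) :
    Primrec fun a => RatCode.powDivFactorial (r a) (k a) :=
  Primrec.nat_rec' hk (.const (1, 0, 0))
    (h := fun a p => RatCode.mul (RatCode.mul p.2 (r a)) (1, 0, p.1))
    (primrec_ratCode_mul
      (primrec_ratCode_mul (.comp .snd .snd) (hr.comp .fst))
      (primrec_ratCode_mk (.const 1) (.const 0) (.comp .fst .snd))).to₂

lemma primrec_egfSum {u v : α → ℕ → ℕ} {r : α → RatCode} {k : α → ℕ} (hu : Primrec₂ u)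
    (hv : Primrec₂ v) (hr : Primrec r) (hk : Primrec k) :
    Primrec fun a => RatCode.egfSum (u a) (v a) (r a) (k a) :=
  Primrec.nat_rec' hk (.const (0, 0, 0))
    (h := fun a p => RatCode.add p.2
      (RatCode.mul (u a p.1, v a p.1, 0) (RatCode.powDivFactorial (r a) p.1)))
    (primrec_ratCode_add (.comp .snd .snd)
      (primrec_ratCode_mul
        (primrec_ratCode_mk (hu.comp .fst (.comp .fst .snd)) (hv.comp .fst (.comp .fst .snd))
          (.const 0))
        (primrec_powDivFactorial (hr.comp .fst) (.comp .fst .snd)))).to₂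

lemma primrec_cutoff {r : α → RatCode} {k : α → ℕ} (hr : Primrec r) (hk : Primrec k) :
    Primrec fun a => RatCode.cutoff (r a) (k a) :=
  Primrec.nat_add.comp (Primrec.nat_add.comp hk (.const 2))
    (Primrec.nat_mul.comp (.const 4)
      (Primrec.nat_add.comp (Primrec.fst.comp hr) (Primrec.fst.comp (Primrec.snd.comp hr))))

lemma primrec_running {M : α → Code} {x k : α → ℕ} (hM : Primrec M) (hx : Primrec x)
    (hk : Primrec k) : Primrec fun a => running (M a) (x a) (k a) :=
  Primrec.ite (Primrec.eq.comp
    (Primrec.option_isSome.comp (Code.primrec_evaln.comp ((hk.pair hM).pair hx))) (.const true))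
    (.const 0) (.const 1)

lemma primrec_half {k : α → ℕ} (hk : Primrec k) : Primrec fun a => (k a + 1) / 2 :=
  Primrec.nat_div.comp (Primrec.succ.comp hk) (.const 2)

lemma primrec_indicatorAll {n : ℕ} (c : Coord n) {l : α → List (Coord n)} (hl : Primrec l) :
    Primrec fun a => indicatorAll c (l a) :=
  Primrec.list_foldr hl (.const 1) (h := fun _ p => if p.1 = c then p.2 else 0)
    (Primrec.ite (Primrec.eq.comp (.comp .fst .snd) (.const c)) (.comp .snd .snd) (.const 0)).to₂

end

lemma primrec_approximation {n : ℕ} (j : Fin n) : Primrec (approximation j) := by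
  have hM : Primrec fun a : (Code × ℕ) × List (Coord n) × RatPt n × ℕ => a.1.1 := .comp .fst .fst
  have hx : Primrec fun a : (Code × ℕ) × List (Coord n) × RatPt n × ℕ => a.1.2 := .comp .snd .fst
  have hl : Primrec fun a : (Code × ℕ) × List (Coord n) × RatPt n × ℕ => a.2.1 := .comp .fst .snd
  have hX : Primrec fun a : (Code × ℕ) × List (Coord n) × RatPt n × ℕ => a.2.2.1 :=
    .comp .fst (.comp .snd .snd)
  have hk : Primrec fun a : (Code × ℕ) × List (Coord n) × RatPt n × ℕ => a.2.2.2 :=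
    .comp .snd (.comp .snd .snd)
  have hq : Primrec fun a : (Code × ℕ) × List (Coord n) × RatPt n × ℕ => a.2.2.1.1 j :=
    Primrec.fin_app.comp (Primrec.fst.comp hX) (.const j)
  have hp : Primrec fun a : (Code × ℕ) × List (Coord n) × RatPt n × ℕ => a.2.2.1.2.1 j :=
    Primrec.fin_app.comp (Primrec.fst.comp (Primrec.snd.comp hX)) (.const j)
  have hi : Primrec fun b : ((Code × ℕ) × List (Coord n) × RatPt n × ℕ) × ℕ =>
      b.2 + b.1.2.1.length :=
    Primrec.nat_add.comp .snd (Primrec.list_length.comp (hl.comp .fst))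
  have hpos : Primrec₂ fun (a : (Code × ℕ) × List (Coord n) × RatPt n × ℕ) i =>
      coeffPos a.1.1 a.1.2 (i + a.2.1.length) :=
    Primrec.nat_mul.comp (.const 2)
      (primrec_running (hM.comp .fst) (hx.comp .fst) (primrec_half hi))
  have hneg : Primrec₂ fun (a : (Code × ℕ) × List (Coord n) × RatPt n × ℕ) i =>
      coeffNeg a.1.1 a.1.2 (i + a.2.1.length) :=
    primrec_running (hM.comp .fst) (hx.comp .fst) (Primrec.pred.comp (primrec_half hi))
  have hsq : Primrec₂ fun (a : (Code × ℕ) × List (Coord n) × RatPt n × ℕ) i =>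
      coeffSquare (i + a.2.1.length) :=
    Primrec.ite (Primrec.eq.comp hi (.const 2)) (.const 2) (.const 0)
  exact primrec_ratCode_add
    (primrec_ratCode_mul (primrec_ratCode_mk (primrec_indicatorAll _ hl) (.const 0) (.const 0))
      (primrec_egfSum hpos hneg hq (primrec_cutoff hq hk)))
    (primrec_ratCode_mul (primrec_ratCode_mk (primrec_indicatorAll _ hl) (.const 0) (.const 0))
      (primrec_egfSum hsq (.const 0) hp (primrec_cutoff hp hk)))

lemma computable_modulus {n : ℕ} :
    Computable fun a : Unit × List (Coord n) × ℕ × ℕ => a.2.2.2 + 2 + 2 * a.2.2.1 := by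
  refine Primrec.to_comp ?_
  have h : Primrec fun a : Unit × List (Coord n) × ℕ × ℕ => a.2.2 := .comp .snd .snd
  exact Primrec.nat_add.comp (Primrec.nat_add.comp (Primrec.snd.comp h) (.const 2))
    (Primrec.nat_mul.comp (.const 2) (Primrec.fst.comp h))

/-- Descriptions of the Hamiltonians `pⱼ² + egf (coeff M x) qⱼ` are computable from `M` and `x`. -/
theorem exists_computable_description {n : ℕ} (j : Fin n) :
    ∃ f : Code × ℕ → Description, Computable f ∧
      ∀ M x, Describes (f (M, x)) (particle j (egf (coeff M x))) := by
  obtain ⟨c, hc, hc'⟩ := exists_computable_code (primrec_approximation j).to_comp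
  -- The modulus does not depend on `M` and `x`, so a single second program serves all; its
  -- parameter is the trivial `Unit`.
  obtain ⟨e, -, he⟩ := exists_computable_code (computable_modulus (n := n))
  refine ⟨fun a => (c a, e ()), hc.pair (.const _), fun M x => ⟨?_, fun l X k => ?_,
    fun l N k => ⟨k + 2 + 2 * N, he () (l, N, k), fun y z hy hz hyz => ?_⟩⟩⟩
  · rw [particle_egf_coeff]
    exact contDiff_egf_add_egf (abs_coeff_le M x) abs_coeffSquare_le j
  · exact ⟨_, hc' (M, x) (l, X, k), abs_val_approximation_sub_le j M x l X k⟩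
  · rw [particle_egf_coeff]
    exact abs_iterPartial_sub_le (abs_coeff_le M x) abs_coeffSquare_le j l hy hz hyz

/-- A many-one reduction of the halting problem to solvability rules out a decision algorithm. -/
theorem not_exists_decidesSolvability {n : ℕ} {σ : SignConvention} {f : Code × ℕ → Description}
    (hf : Computable f) (h : ∀ M x, ∃ H : PhasePt n → ℝ, Describes (f (M, x)) H ∧
      ((M.eval x).Dom ↔ GloballySolvable σ H)) :
    ¬ ∃ D : Description →. Bool, Partrec D ∧ DecidesSolvability n σ D := by
  rintro ⟨D, hD, hD'⟩
  have key (M : Code) : ∃ b ∈ D (f (M, 0)), (b = true ↔ (M.eval 0).Dom) := by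
    obtain ⟨H, hH, hH'⟩ := h M 0
    rw [hH']
    exact hD' _ H hH
  -- `D` may diverge elsewhere, but it halts on all the values `f (M, 0)`; composed with `f` it
  -- would be a total decision procedure for halting on input `0`.
  choose g hg hg' using key
  refine ComputablePred.halting_problem 0 (ComputablePred.computable_iff.2 ⟨g, ?_, ?_⟩)
  · exact (hD.comp (hf.comp (Computable.id.pair (.const 0)))).of_eq fun M =>
      Part.eq_some_iff.2 (hg M)
  · exact funext fun M => propext (hg' M).symm

end Computability

end HPF

theorem theorem1 (n : ℕ) (hn : 1 ≤ n) (σ : HPF.SignConvention) :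
    (¬ ∃ D : HPF.Description →. Bool, Partrec D ∧ HPF.DecidesSolvability n σ D) ∧
    (∃ f : Nat.Partrec.Code × ℕ → HPF.Description, Computable f ∧
      ∀ (M : Nat.Partrec.Code) (x : ℕ), ∃ H : HPF.PhasePt n → ℝ,
        HPF.Describes (f (M, x)) H ∧
        ((M.eval x).Dom ↔ HPF.GloballySolvable σ H) ∧
        ((M.eval x).Dom →
          ∃ S : HPF.EndPts n → ℝ, ContDiff ℝ ∞ S ∧ HPF.SolvesPair H S σ)) := by
  let j : Fin n := ⟨0, hn⟩
  obtain ⟨f, hf, hdesc⟩ := HPF.exists_computable_description j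
  have hsol {M : Nat.Partrec.Code} {x : ℕ} (h : (M.eval x).Dom) :
      ∃ S : HPF.EndPts n → ℝ, ContDiff ℝ ∞ S ∧
        HPF.SolvesPair (HPF.particle j (HPF.egf (HPF.coeff M x))) S σ :=
    let ⟨_, hB⟩ := HPF.exists_egf_coeff_le h
    HPF.exists_contDiff_solvesPair_particle j σ (HPF.contDiff_egf (HPF.abs_coeff_le M x)) hB
  have hiff (M : Nat.Partrec.Code) (x : ℕ) : (M.eval x).Dom ↔
      HPF.GloballySolvable σ (HPF.particle j (HPF.egf (HPF.coeff M x))) := by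
    refine ⟨fun h => HPF.globallySolvable_of_contDiff (hsol h), fun h => ?_⟩
    by_contra hM
    rw [HPF.egf_coeff_of_not_dom hM] at h
    exact HPF.not_globallySolvable_particle_exp j σ h
  exact ⟨HPF.not_exists_decidesSolvability hf fun M x => ⟨_, hdesc M x, hiff M x⟩,
    f, hf, fun M x => ⟨_, hdesc M x, hiff M x, hsol⟩⟩
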